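/- Let $G=(V,E)$ be a finite planar graph (loops and multiple edges are allowed), given with an embedding in the sphere; if $G$ is not connected, each connected component is taken with its own embedding in the sphere. Let $J=(J_e)_{e\in E}$ be positive coupling constants. The Ising model on $G$ (free boundary conditions) assigns to $\sigma\in\{-1,1\}^V$ the probability $$\mathbb P(\sigma)=\frac{1}{Z_{\mathrm{Ising}}(G,J)}\exp\Bigl(\sum_{e=uv\in E}J_e\sigma_u\sigma_v\Bigr),$$ where $Z_{\mathrm{Ising}}(G,J)$ is the normalizing constant; $\mathbb E$ denotes expectation under $\mathbb P$. Let $u_1,\dots,u_{2n}$ be vertices of $G$ and let $\gamma_1,\dots,\gamma_n$ be loop-free paths in $G$, no two of which share an edge, such that $\gamma_j$ joins $u_{2j-1}$ to $u_{2j}$. Let $\Gamma\subset E$ be the set of edges of these paths, and put $\bar J_e=J_e+i\frac{\pi}{2}$ for $e\in\Gamma$ and $\bar J_e=J_e$ otherwise. Superimpose $G$, its dual graph $G^*$ and the quad-graph (which joins each dual vertex to the corners of the corresponding face of $G$), and add a vertex at the crossing of each edge $e$ with its dual edge $e^*$; the bipartite graph $G^Q$ is the dual of the graph so obtained (for disconnected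 $G$: the disjoint union of the graphs obtained from the components). It consists of one quadrangle for each edge $e$ of $G$, with two edges parallel to $e$ and two edges parallel to $e^*$, and of legs, which cross the edges of the quad-graph and connect the quadrangles. For (possibly complex) coupling constants $K$, let $\nu(K)$ be the weight function on the edges of $G^Q$ that is equal to $1$ on legs, to $\tanh(2K_e)$ on edges parallel to $e$, and to $1/\cosh(2K_e)$ on edges parallel to $e^*$. Let $Z_{\mathrm{dimer}}(G^Q,\nu)=\sum_{M}\prod_{\mathsf e\in M}\nu_{\mathsf e}$, where $M$ runs over the perfect matchings of $G^Q$. Then $\nu(\bar J)$ is equal to $1$ on legs, to $\tanh(2J_e)$ on edges parallel to an edge $e$ of $G$, to $1/\cosh(2J_e)$ on edges parallel to $e^*$ with $e\notin\Gamma$, and to $-1/\cosh(2J_e)$ on edges parallel to $e^*$ with $e\in\Gamma$. Moreover $Z_{\mathrm{dimer}}(G^Q,\nu(J))\neq 0$ and $$\mathbb E[\sigma_{u_1}\cdots\sigma_{u_{2n}}]^2=\frac{Z_{\mathrm{dimer}}(G^Q,\nu(\bar J))}{Z_{\mathrm{dimer}}(G^Q,\nu(J))}.$$ -/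

import Mathlib

/-!
Graphs are finite multigraphs with vertex type `V` and edge type `E` (loops and multiple edges are
allowed).  Every edge `e` has two half-edges `(e, false)` and `(e, true)`, each attached to one
endpoint of `e`.  An embedding into an oriented surface is recorded, up to homeomorphism, by its
rotation system: the counterclockwise cyclic order of the half-edges around each vertex.
-/

/-- A finite multigraph embedded in an oriented surface.
`vert h` is the vertex at which the half-edge `h` starts, and `rot h` is the half-edge following `h`
in counterclockwise order around `vert h`. -/
structure EmbeddedGraph (V E : Type*) where
  vert : E × Bool → V
  rot : Equiv.Perm (E × Bool)
  sameCycle_rot_iff : ∀ h h' : E × Bool, rot.SameCycle h h' ↔ vert h = vert h'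

namespace EmbeddedGraph

variable {V E : Type*}

/-- The opposite half-edge of the same edge. -/
def opp : Equiv.Perm (E × Bool) :=
  Function.Involutive.toPerm (fun h => (h.1, !h.2)) (fun h => by simp)

/-- Follow the half-edge `h` to its other end, with a face on the left, and return the next half-edge
on the boundary of that face. -/
def facePerm (G : EmbeddedGraph V E) : Equiv.Perm (E × Bool) := G.rot⁻¹ * opp

/-- Adjacency of distinct vertices. -/
def adjGraph (G : EmbeddedGraph V E) : SimpleGraph V :=
  SimpleGraph.fromRel fun u v => ∃ e : E, G.vert (e, false) = u ∧ G.vert (e, true) = v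

/-- The number of connected components. -/
noncomputable def numComponents (G : EmbeddedGraph V E) : ℕ :=
  Nat.card G.adjGraph.ConnectedComponent

/-- The number of faces, each component being embedded in a surface of its own: the cycles of
`facePerm`, and one face for each isolated vertex (embedded alone in a sphere). -/
noncomputable def numFaces (G : EmbeddedGraph V E) : ℕ :=
  Nat.card (Quotient (Equiv.Perm.SameCycle.setoid G.facePerm)) +
    Nat.card {v : V // ∀ h, G.vert h ≠ v}

/-- Planarity: `|V| - |E| + |F|` is twice the number of components, that is, by Euler's formula,
every component is embedded in the sphere.  For a connected graph it reads `|V| - |E| + |F| = 2`. -/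
def IsPlanar (G : EmbeddedGraph V E) : Prop :=
  Nat.card V + G.numFaces = Nat.card E + 2 * G.numComponents

/-! ### Paths -/

/-- `l` is a list of consecutive half-edges, each traversed from its vertex to the other end, leading
from `u` to `v`. -/
def IsWalk (G : EmbeddedGraph V E) : V → List (E × Bool) → V → Prop
  | u, [], v => u = v
  | u, h :: l, v => G.vert h = u ∧ G.IsWalk (G.vert (opp h)) l v

/-- A loop-free path from `u` to `v`: a walk that visits no vertex twice. -/
def IsPath (G : EmbeddedGraph V E) (u : V) (l : List (E × Bool)) (v : V) : Prop :=
  G.IsWalk u l v ∧ (u :: l.map fun h => G.vert (opp h)).Nodup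

/-! ### The Ising model -/

section Ising

variable [Fintype V] [DecidableEq V] [Fintype E]

/-- The exponent `∑_{e = uv} J_e s_u s_v` for a spin configuration `s` (`ℤˣ = {1, -1}`). -/
noncomputable def isingExponent (G : EmbeddedGraph V E) (J : E → ℝ) (s : V → ℤˣ) : ℝ :=
  ∑ e : E, J e * ((s (G.vert (e, false)) : ℤ) : ℝ) * ((s (G.vert (e, true)) : ℤ) : ℝ)

/-- The Ising partition function (free boundary conditions). -/
noncomputable def isingZ (G : EmbeddedGraph V E) (J : E → ℝ) : ℝ :=
  ∑ s : V → ℤˣ, Real.exp (G.isingExponent J s)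

/-- The Ising Boltzmann probability of a spin configuration. -/
noncomputable def isingProb (G : EmbeddedGraph V E) (J : E → ℝ) (s : V → ℤˣ) : ℝ :=
  Real.exp (G.isingExponent J s) / G.isingZ J

/-- Expectation under the Ising Boltzmann measure. -/
noncomputable def isingExp (G : EmbeddedGraph V E) (J : E → ℝ) (f : (V → ℤˣ) → ℝ) : ℝ :=
  ∑ s : V → ℤˣ, G.isingProb J s * f s

end Ising

/-! ### The bipartite graph `G^Q`

The superposition of `G`, its dual and the quad-graph, with a vertex added at each crossing of a
primal edge with its dual edge, has triangular faces; each is bounded by half of a primal edge (a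
half-edge `h`), half of the dual edge, and an edge of the quad-graph, and it is given by `h` and the
side of `h` on which it lies.  These triangles are the vertices of `G^Q`, and two of them are joined
by one edge of `G^Q` for each side that they share. -/

/-- Vertices of `G^Q`: `(h, true)` is the triangle to the left of the half-edge `h`, and `(h, false)`
is the triangle to its right. -/
abbrev QVertex (E : Type*) := (E × Bool) × Bool

/-- Edges of `G^Q`. -/
inductive QEdge (E : Type*)
  /-- The leg crossing the quad-graph edge in the corner between `h` and `rot h`. -/
  | leg (h : E × Bool)
  /-- The quadrangle edge crossing the half of the dual edge that lies to the left of `h`; it is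
  parallel to the primal edge `h.1`. -/
  | primalParallel (h : E × Bool)
  /-- The quadrangle edge crossing the half-edge `h`; it is parallel to the dual edge of `h.1`. -/
  | dualParallel (h : E × Bool)
  deriving DecidableEq, Fintype

/-- The endpoints of an edge of `G^Q`. -/
def qEnds (G : EmbeddedGraph V E) : QEdge E → Sym2 (QVertex E)
  | .leg h => s((h, true), (G.rot h, false))
  | .primalParallel h => s((h, true), (opp h, false))
  | .dualParallel h => s((h, true), (h, false))

/-- The dimer weights `ν(K)` for (possibly complex) coupling constants `K`. -/
noncomputable def dimerWeight (K : E → ℂ) : QEdge E → ℂ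
  | .leg _ => 1
  | .primalParallel h => Complex.tanh (2 * K h.1)
  | .dualParallel h => (Complex.cosh (2 * K h.1))⁻¹

/-- The real coupling constants `J`, as complex numbers. -/
noncomputable def coupling (J : E → ℝ) : E → ℂ := fun e => (J e : ℂ)

/-- The set of edges used by a family of paths. -/
def pathEdges {ι : Type*} (γ : ι → List (E × Bool)) : Set E :=
  {e | ∃ j, ∃ h ∈ γ j, h.1 = e}

open Classical in
/-- The coupling constants modified by order along `Γ`: add `iπ/2` on the edges of `Γ`. -/
noncomputable def orderCoupling (J : E → ℝ) (Γ : Set E) : E → ℂ := fun e =>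
  if e ∈ Γ then (J e : ℂ) + Complex.I * ((Real.pi : ℂ) / 2) else (J e : ℂ)

end EmbeddedGraph

/-! ### The dimer model -/

/-- A dimer configuration (perfect matching) of the multigraph with endpoint map `ends`: a set of
edges such that each vertex is incident to exactly one of them. -/
def IsDimer {W F : Type*} (ends : F → Sym2 W) (M : Finset F) : Prop :=
  ∀ w : W, ∃! f : F, f ∈ M ∧ w ∈ ends f

open Classical in
/-- The dimer partition function of the multigraph with endpoint map `ends` and edge weights `ν`. -/
noncomputable def dimerZ {W F : Type*} [Fintype F] (ends : F → Sym2 W) (ν : F → ℂ) : ℂ :=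
  ∑ M : Finset F with IsDimer ends M, ∏ f ∈ M, ν f

/-! Both models are compared with one sum over pairs `(P, D)` of disjoint edge sets, `P` even at
every vertex and `D` the coboundary of a vertex function, where an edge weighs tanh(2K) if it is in
`P`, 1/cosh(2K) if it is in `D`, and 1 otherwise.

Ising side (`complexIsingZ_sq`): in the square of the partition function, `D` records where the
product of the two spin copies changes sign. Given `D`, the two couplings cancel on `D` and add up
to 2K off it; the high-temperature expansion of the remaining copy produces `P`.

Dimer side (`IsPlanar.dimerZ_eq`): once the legs are chosen the quadrangles decouple, and tanh² +
1/cosh² = 1 gives weight 1 to a quadrangle without legs (`sum_quadWeight`). Jumps of the leg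
indicator across half-edges and across halves of dual edges are `P` and `D`. Planarity, through a
dimension count modulo 2, says that every pair arises, and linearity that all arise equally often
(`IsPlanar.map_cornerDiff`).

Hence `IsPlanar.complexIsingZ_sq_eq`: Z_Ising² = C ∏ cosh(2K_e) Z_dimer, with C ≠ 0 independent of
K, for all complex K with cosh(2K_e) ≠ 0. Shifting K by iπ/2 on Γ inserts i^|Γ| times the product of
the edge spins over Γ. After squaring, the sign (-1)^|Γ| cancels the one coming from the cosh
factors, and the edge spins telescope along the paths to the spins at the endpoints. -/

/-! ### Linear algebra over `ZMod 2` -/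

/-- Rank-nullity for a pair of adjoint linear maps. -/
theorem finrank_ker_add_card_of_adjoint {F m n : Type*} [Field F] [Fintype m] [Fintype n]
    (L : (m → F) →ₗ[F] (n → F)) (L' : (n → F) →ₗ[F] (m → F))
    (h : ∀ x y, L x ⬝ᵥ y = x ⬝ᵥ L' y) :
    Module.finrank F (LinearMap.ker L) + Fintype.card n =
      Module.finrank F (LinearMap.ker L') + Fintype.card m := by
  classical
  have hT : LinearMap.toMatrix' L' = (LinearMap.toMatrix' L).transpose := by
    ext i j
    have := h (Pi.single i 1) (Pi.single j 1)
    simp only [dotProduct_single_one, single_one_dotProduct] at this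
    simp [LinearMap.toMatrix'_apply, this]
  have hr : Module.finrank F (LinearMap.range L') = Module.finrank F (LinearMap.range L) := by
    have := Matrix.rank_transpose (LinearMap.toMatrix' L)
    rw [← hT] at this
    rw [Matrix.rank, Matrix.rank, ← Matrix.toLin'_apply', ← Matrix.toLin'_apply',
      Matrix.toLin'_toMatrix', Matrix.toLin'_toMatrix'] at this
    exact this
  have h1 := L.finrank_range_add_finrank_ker
  have h2 := L'.finrank_range_add_finrank_ker
  simp only [Module.finrank_fintype_fun_eq_card] at h1 h2
  omega

/-- Every nonempty fibre of a linear map is a translate of the kernel, so all fibres have the same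
size. -/
theorem sum_comp_linearMap {F M N : Type*} [Field F] [AddCommGroup M] [Module F M]
    [AddCommGroup N] [Module F N] [Fintype M] [Fintype N] (L : M →ₗ[F] N)
    [DecidablePred (· ∈ LinearMap.range L)] (g : N → ℂ) :
    ∑ x, g (L x) = (Nat.card (LinearMap.ker L) : ℂ) * ∑ y with y ∈ LinearMap.range L, g y := by
  classical
  rw [Finset.sum_comp g L, Finset.mul_sum]
  have himg : Finset.image L Finset.univ = Finset.univ.filter (· ∈ LinearMap.range L) := by
    ext y; simp
  rw [himg]
  refine Finset.sum_congr rfl fun y hy => ?_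
  rw [Finset.mem_filter] at hy
  obtain ⟨x, rfl⟩ := hy.2
  rw [nsmul_eq_mul]
  congr 2
  rw [Nat.card_eq_fintype_card, ← Fintype.card_subtype]
  refine Fintype.card_congr ?_
  exact {
    toFun := fun a => ⟨a.1 - x, by simp [LinearMap.mem_ker, a.2]⟩
    invFun := fun a => ⟨a.1 + x, by simp [LinearMap.mem_ker.1 a.2]⟩
    left_inv := fun a => by simp
    right_inv := fun a => by simp }

theorem finrank_map_of_injective {F M N : Type*} [Field F] [AddCommGroup M] [Module F M]
    [AddCommGroup N] [Module F N] (L : M →ₗ[F] N) (hL : Function.Injective L)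
    (p : Submodule F M) : Module.finrank F (p.map L) = Module.finrank F p :=
  (Submodule.equivMapOfInjective L hL p).symm.finrank_eq

theorem finrank_submodule_prod {F M N : Type*} [Field F] [AddCommGroup M] [Module F M]
    [AddCommGroup N] [Module F N] [FiniteDimensional F M] [FiniteDimensional F N]
    (p : Submodule F M) (q : Submodule F N) :
    Module.finrank F (p.prod q) = Module.finrank F p + Module.finrank F q := by
  have hr : LinearMap.range (p.subtype.prodMap q.subtype) = p.prod q := by
    rw [LinearMap.range_prodMap, Submodule.range_subtype, Submodule.range_subtype]
  rw [← Module.finrank_prod, ← hr, LinearMap.finrank_range_of_inj]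
  exact p.subtype_injective.prodMap q.subtype_injective

theorem zmod_two_add_eq_zero_iff (a b : ZMod 2) : a + b = 0 ↔ a = b := by
  revert a b; decide

theorem perm_apply_inv_self {α : Type*} (p : Equiv.Perm α) (a : α) : p (p⁻¹ a) = a :=
  p.apply_symm_apply a

theorem perm_inv_apply_self {α : Type*} (p : Equiv.Perm α) (a : α) : p⁻¹ (p a) = a :=
  p.symm_apply_apply a

theorem sameCycle_apply_eq {α β : Type*} {p : Equiv.Perm α} {f : α → β}
    (hf : ∀ a, f (p a) = f a) {a b : α} (h : p.SameCycle a b) : f a = f b := by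
  obtain ⟨k, rfl⟩ := h
  induction k using Int.induction_on with
  | zero => simp
  | succ k ih => rw [ih, add_comm, zpow_add, zpow_one, Equiv.Perm.mul_apply, hf]
  | pred k ih =>
    rw [ih, sub_eq_add_neg, add_comm, zpow_add, Equiv.Perm.mul_apply, zpow_neg_one,
      ← hf (p⁻¹ _), perm_apply_inv_self]

/-! ### Cycles, coboundaries and faces modulo 2 -/

namespace EmbeddedGraph

variable {V E X : Type*}

/-- The coboundary modulo 2 of a function on the vertices, half-edges being attached to the vertices
by `p`. -/
def coboundary (p : E × Bool → X) : (X → ZMod 2) →ₗ[ZMod 2] (E → ZMod 2) where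
  toFun x e := x (p (e, false)) + x (p (e, true))
  map_add' x y := by ext e; simp; ring
  map_smul' c x := by ext e; simp; ring

/-- The boundary modulo 2 of a set of edges, half-edges being attached to the vertices by `p`. -/
def boundary [Fintype E] [DecidableEq X] (p : E × Bool → X) :
    (E → ZMod 2) →ₗ[ZMod 2] (X → ZMod 2) where
  toFun y v := ∑ h, if p h = v then y h.1 else 0
  map_add' x y := by
    ext v
    simp only [Pi.add_apply, ← Finset.sum_add_distrib]
    exact Finset.sum_congr rfl fun h _ => by split_ifs <;> simp
  map_smul' c x := by
    ext v
    simp [Finset.mul_sum]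

theorem coboundary_apply (p : E × Bool → X) (x : X → ZMod 2) (e : E) :
    coboundary p x e = x (p (e, false)) + x (p (e, true)) := rfl

theorem boundary_apply [Fintype E] [DecidableEq X] (p : E × Bool → X) (y : E → ZMod 2) (v : X) :
    boundary p y v = ∑ h, if p h = v then y h.1 else 0 := rfl

theorem coboundary_dotProduct [Fintype E] [Fintype X] [DecidableEq X] (p : E × Bool → X)
    (x : X → ZMod 2) (y : E → ZMod 2) : coboundary p x ⬝ᵥ y = x ⬝ᵥ boundary p y := by
  simp only [dotProduct, coboundary_apply, boundary_apply, Finset.mul_sum]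
  rw [Finset.sum_comm, Fintype.sum_prod_type]
  refine Finset.sum_congr rfl fun e _ => ?_
  simp only [mul_ite, mul_zero, Finset.sum_ite_eq, Finset.mem_univ, if_true, Fintype.sum_bool]
  ring

@[simp] theorem opp_opp (h : E × Bool) : opp (opp h) = h :=
  Function.Involutive.toPerm_involutive _ h

theorem opp_mk (e : E) (b : Bool) : opp (e, b) = (e, !b) := rfl

variable (G : EmbeddedGraph V E)

theorem vert_rot (h : E × Bool) : G.vert (G.rot h) = G.vert h :=
  ((G.sameCycle_rot_iff _ _).1 ⟨1, by simp⟩).symm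

theorem vert_rot_inv (h : E × Bool) : G.vert (G.rot⁻¹ h) = G.vert h := by
  rw [← G.vert_rot, perm_apply_inv_self]

theorem facePerm_apply (h : E × Bool) : G.facePerm h = G.rot⁻¹ (opp h) := rfl

theorem vert_facePerm (h : E × Bool) : G.vert (G.facePerm h) = G.vert (opp h) := by
  rw [facePerm_apply, vert_rot_inv]

/-- The type of faces bounded by edges. -/
abbrev Face : Type _ := Quotient (Equiv.Perm.SameCycle.setoid G.facePerm)

/-- The face to the left of a half-edge. -/
def face (h : E × Bool) : G.Face := Quotient.mk _ h

theorem face_facePerm (h : E × Bool) : G.face (G.facePerm h) = G.face h :=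
  Quotient.sound (s := Equiv.Perm.SameCycle.setoid G.facePerm)
    (Equiv.Perm.SameCycle.symm ⟨1, by simp⟩)

theorem face_surjective : Function.Surjective G.face := Quotient.mk_surjective

/-- Functions of the half-edge that depend on the connected component only. -/
def invariants : Submodule (ZMod 2) (E × Bool → ZMod 2) where
  carrier := {f | ∀ h, f (G.rot h) = f h ∧ f (opp h) = f h}
  add_mem' hf hg h := by simp [hf h, hg h]
  zero_mem' h := by simp
  smul_mem' c f hf h := by simp [hf h]

theorem mem_invariants {f : E × Bool → ZMod 2} :
    f ∈ G.invariants ↔ ∀ h, f (G.rot h) = f h ∧ f (opp h) = f h := Iff.rfl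

theorem mem_ker_coboundary (p : E × Bool → X) (x : X → ZMod 2) :
    x ∈ LinearMap.ker (coboundary p) ↔ ∀ h, x (p (opp h)) = x (p h) := by
  rw [LinearMap.mem_ker, funext_iff]
  simp only [coboundary_apply, Pi.zero_apply, zmod_two_add_eq_zero_iff]
  constructor
  · rintro hx ⟨e, b⟩
    cases b
    · exact (hx e).symm
    · exact hx e
  · intro hx e
    exact (hx (e, false)).symm

/-- A vertex function has zero coboundary exactly when it factors through the connected components.
-/
theorem finrank_ker_coboundary_vert [Finite V] :
    Module.finrank (ZMod 2) (LinearMap.ker (coboundary G.vert)) = G.numComponents := by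
  classical
  have := Fintype.ofFinite V
  let mk : V → G.adjGraph.ConnectedComponent := G.adjGraph.connectedComponentMk
  have hmk : Function.Surjective mk := Quot.mk_surjective
  have hinj := LinearMap.funLeft_injective_of_surjective (ZMod 2) (ZMod 2) mk hmk
  have hrange : LinearMap.range (LinearMap.funLeft (ZMod 2) (ZMod 2) mk) =
      LinearMap.ker (coboundary G.vert) := by
    ext x
    rw [mem_ker_coboundary]
    constructor
    · rintro ⟨y, rfl⟩ h
      simp only [LinearMap.funLeft_apply]
      congr 1
      by_cases hv : G.vert (opp h) = G.vert h
      · rw [hv]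
      · refine SimpleGraph.ConnectedComponent.sound (SimpleGraph.Adj.reachable ?_)
        rw [adjGraph, SimpleGraph.fromRel_adj]
        refine ⟨hv, ?_⟩
        obtain ⟨e, b⟩ := h
        cases b
        · exact Or.inr ⟨e, rfl, rfl⟩
        · exact Or.inl ⟨e, rfl, rfl⟩
    · intro hx
      have hadj : ∀ v w, G.adjGraph.Adj v w → x v = x w := by
        intro v w hvw
        rw [adjGraph, SimpleGraph.fromRel_adj] at hvw
        rcases hvw.2 with ⟨e, rfl, rfl⟩ | ⟨e, rfl, rfl⟩
        · exact (hx (e, false)).symm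
        · exact hx (e, false)
      have hwalk : ∀ v w, ∀ p : G.adjGraph.Walk v w, x v = x w := by
        intro v w p
        induction p with
        | nil => rfl
        | cons h _ ih => exact (hadj _ _ h).trans ih
      refine ⟨SimpleGraph.ConnectedComponent.lift x fun v w p _ => hwalk v w p, ?_⟩
      ext v
      simp [LinearMap.funLeft_apply, mk]
  rw [← hrange, LinearMap.finrank_range_of_inj hinj, numComponents, Nat.card_eq_fintype_card,
    Module.finrank_fintype_fun_eq_card]

/-- Isolated vertices carry no half-edge, so `invariants` misses them; they must be counted apart,
just as `numFaces` does. -/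
theorem finrank_ker_coboundary_vert_eq_add [Finite V] [Finite E] :
    Module.finrank (ZMod 2) (LinearMap.ker (coboundary G.vert)) =
      Module.finrank (ZMod 2) G.invariants + Nat.card {v : V // ∀ h, G.vert h ≠ v} := by
  classical
  have := Fintype.ofFinite V
  have := Fintype.ofFinite E
  let ψ : (V → ZMod 2) →ₗ[ZMod 2]
      (E × Bool → ZMod 2) × ({v : V // ∀ h, G.vert h ≠ v} → ZMod 2) :=
    (LinearMap.funLeft (ZMod 2) (ZMod 2) G.vert).prod
      (LinearMap.funLeft (ZMod 2) (ZMod 2) Subtype.val)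
  have hψ : Function.Injective ψ := by
    intro x y hxy
    ext v
    by_cases hv : ∃ h, G.vert h = v
    · obtain ⟨h, rfl⟩ := hv
      exact congrFun (congrArg Prod.fst hxy) h
    · push Not at hv
      exact congrFun (congrArg Prod.snd hxy) ⟨v, hv⟩
  have hmap : (LinearMap.ker (coboundary G.vert)).map ψ = G.invariants.prod ⊤ := by
    ext ⟨f, z⟩
    simp only [Submodule.mem_map, mem_ker_coboundary, Submodule.mem_prod, Submodule.mem_top,
      and_true, mem_invariants]
    constructor
    · rintro ⟨x, hx, hxf⟩ h
      obtain rfl : x ∘ G.vert = f := congrArg Prod.fst hxf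
      exact ⟨congrArg x (G.vert_rot h), hx h⟩
    · intro hf
      have hvert : ∀ h h', G.vert h = G.vert h' → f h = f h' := fun h h' hh =>
        sameCycle_apply_eq (fun a => (hf a).1) ((G.sameCycle_rot_iff h h').2 hh)
      -- At a non-isolated vertex, the value is read at any half-edge there; `hvert` makes the
      -- choice irrelevant.
      let x : V → ZMod 2 := fun v =>
        if hv : ∀ h, G.vert h ≠ v then z ⟨v, hv⟩ else f (not_forall.1 hv).choose
      have hx : ∀ h, x (G.vert h) = f h := by
        intro h
        have hv : ¬ ∀ h', G.vert h' ≠ G.vert h := fun hh => hh h rfl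
        simp only [x, dif_neg hv]
        exact hvert _ _ (not_not.1 (not_forall.1 hv).choose_spec)
      refine ⟨x, fun h => by rw [hx, hx, (hf h).2], Prod.ext (funext hx) (funext fun v => ?_)⟩
      exact dif_pos v.2
  rw [← finrank_map_of_injective ψ hψ, hmap, finrank_submodule_prod, finrank_top,
    Module.finrank_fintype_fun_eq_card, Nat.card_eq_fintype_card]

/-- Since `facePerm` is `rot⁻¹ * opp`, invariance under `facePerm` and `opp` is the same as
invariance under `rot` and `opp`: the dual graph has the same components. -/
theorem finrank_ker_coboundary_face :
    Module.finrank (ZMod 2) (LinearMap.ker (coboundary G.face)) =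
      Module.finrank (ZMod 2) G.invariants := by
  have hψ := LinearMap.funLeft_injective_of_surjective (ZMod 2) (ZMod 2) G.face G.face_surjective
  have hmap : (LinearMap.ker (coboundary G.face)).map (LinearMap.funLeft (ZMod 2) (ZMod 2) G.face) =
      G.invariants := by
    ext f
    simp only [Submodule.mem_map, mem_ker_coboundary, mem_invariants]
    constructor
    · rintro ⟨x, hx, rfl⟩ h
      simp only [LinearMap.funLeft_apply]
      refine ⟨?_, hx h⟩
      rw [← hx (G.rot h), ← G.face_facePerm, facePerm_apply, opp_opp, perm_inv_apply_self]
    · intro hf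
      have hface : ∀ h, f (G.facePerm h) = f h := by
        intro h
        rw [facePerm_apply, ← (hf (G.rot⁻¹ (opp h))).1, perm_apply_inv_self, (hf h).2]
      exact ⟨Quotient.lift f fun a b hab => sameCycle_apply_eq hface hab, fun h => (hf h).2, rfl⟩
  rw [← finrank_map_of_injective _ hψ, hmap]

/-! ### Leg configurations as functions of the corners -/

/-- The local relation at each edge satisfied by the legs of a dimer configuration: the linear map
whose kernel consists of the functions of the corner (the corner between `h` and `rot h` being
labelled by `h`) with zero sum over the four corners at each edge. -/
def cornerSum : (E × Bool → ZMod 2) →ₗ[ZMod 2] (E → ZMod 2) where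
  toFun f e := ∑ b, (f (e, b) + f (G.rot⁻¹ (e, b)))
  map_add' f g := by ext e; simp; ring
  map_smul' c f := by ext e; simp; ring

theorem cornerSum_apply (f : E × Bool → ZMod 2) (e : E) :
    G.cornerSum f e = ∑ b, (f (e, b) + f (G.rot⁻¹ (e, b))) := rfl

/-- The transpose of `cornerSum`. -/
def cornerSumTranspose : (E → ZMod 2) →ₗ[ZMod 2] (E × Bool → ZMod 2) where
  toFun y h := y h.1 + y (G.rot h).1
  map_add' f g := by ext e; simp; ring
  map_smul' c f := by ext e; simp; ring

theorem cornerSumTranspose_apply (y : E → ZMod 2) (h : E × Bool) :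
    G.cornerSumTranspose y h = y h.1 + y (G.rot h).1 := rfl

theorem cornerSumTranspose_dotProduct [Fintype E] (y : E → ZMod 2) (f : E × Bool → ZMod 2) :
    G.cornerSumTranspose y ⬝ᵥ f = y ⬝ᵥ G.cornerSum f := by
  have h1 : y ⬝ᵥ G.cornerSum f = ∑ h : E × Bool, y h.1 * (f h + f (G.rot⁻¹ h)) := by
    simp only [dotProduct, cornerSum_apply, Fintype.sum_prod_type, Finset.mul_sum]
  have h2 : ∑ h : E × Bool, y h.1 * f (G.rot⁻¹ h) = ∑ h : E × Bool, y (G.rot h).1 * f h := by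
    rw [← Equiv.sum_comp G.rot]
    simp only [perm_inv_apply_self]
  rw [h1]
  simp only [dotProduct, cornerSumTranspose_apply, mul_add, add_mul, Finset.sum_add_distrib, h2]

theorem finrank_ker_cornerSumTranspose :
    Module.finrank (ZMod 2) (LinearMap.ker G.cornerSumTranspose) =
      Module.finrank (ZMod 2) G.invariants := by
  have hψ := LinearMap.funLeft_injective_of_surjective (ZMod 2) (ZMod 2)
    (Prod.fst : E × Bool → E) Prod.fst_surjective
  have hmap : (LinearMap.ker G.cornerSumTranspose).map
      (LinearMap.funLeft (ZMod 2) (ZMod 2) (Prod.fst : E × Bool → E)) = G.invariants := by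
    ext f
    simp only [Submodule.mem_map, LinearMap.mem_ker, mem_invariants, funext_iff,
      cornerSumTranspose_apply, Pi.zero_apply, zmod_two_add_eq_zero_iff, LinearMap.funLeft_apply]
    constructor
    · rintro ⟨y, hy, hf⟩ h
      simp only [← hf]
      exact ⟨(hy h).symm, rfl⟩
    · intro hf
      have hfst : ∀ h : E × Bool, f (h.1, false) = f h := by
        rintro ⟨e, b⟩
        cases b
        · rfl
        · exact (hf (e, true)).2
      exact ⟨fun e => f (e, false), fun h => by simp only [hfst, (hf h).1], hfst⟩
  rw [← finrank_map_of_injective _ hψ, hmap]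

/-- The differences of a function of the corner across half-edges and across halves of dual edges. -/
def cornerDiff : (E × Bool → ZMod 2) →ₗ[ZMod 2] (E → ZMod 2) × (E → ZMod 2) where
  toFun f := (fun e => f (e, false) + f (G.rot⁻¹ (e, false)),
    fun e => f (e, false) + f (G.facePerm (e, false)))
  map_add' f g := by ext e <;> simp <;> ring
  map_smul' c f := by ext e <;> simp <;> ring

/-- `cornerDiff` is defined from the half-edge `(e, false)` only. The vanishing sum over the four
corners makes opposite jumps agree, so either half-edge may be used. -/
theorem cornerDiff_of_mem_ker {f : E × Bool → ZMod 2} (hf : f ∈ LinearMap.ker G.cornerSum)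
    (h : E × Bool) :
    (G.cornerDiff f).1 h.1 = f h + f (G.rot⁻¹ h) ∧
      (G.cornerDiff f).2 h.1 = f h + f (G.facePerm h) := by
  obtain ⟨e, b⟩ := h
  cases b
  · exact ⟨rfl, rfl⟩
  · have := congrFun hf e
    simp only [cornerSum_apply, Fintype.sum_bool, Pi.zero_apply] at this
    simp only [cornerDiff, LinearMap.coe_mk, AddHom.coe_mk, facePerm_apply, opp_mk, Bool.not_false,
      Bool.not_true]
    have key : ∀ a b c d : ZMod 2, a + c + (b + d) = 0 → b + d = a + c ∧ b + c = a + d := by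
      decide
    exact key _ _ _ _ this

/-- Since `q` is constant along the cycles of `p`, each value of `f` with the prescribed `q` is
counted twice. Applied to `rot⁻¹` and `facePerm`, this says that jumps around a vertex or a face sum
to zero. -/
theorem sum_ite_apply_perm {α β : Type*} [Fintype α] [DecidableEq β] {p : Equiv.Perm α}
    {q : α → β} (hq : ∀ a, q (p a) = q a) (f : α → ZMod 2) (v : β) :
    (∑ a, if q a = v then f a + f (p a) else 0) = 0 := by
  have h1 : (∑ a, if q a = v then f (p a) else 0) = ∑ a, if q a = v then f a else 0 := by
    rw [← Equiv.sum_comp p fun a => if q a = v then f a else 0]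
    simp only [hq]
  have h2 : ∀ a, (if q a = v then f a + f (p a) else 0) =
      (if q a = v then f a else 0) + if q a = v then f (p a) else 0 := fun a => by
    split_ifs <;> simp
  simp only [h2, Finset.sum_add_distrib, h1, CharTwo.add_self_eq_zero]

variable {G} in
theorem range_coboundary_le [Fintype E] [DecidableEq G.Face] :
    LinearMap.range (coboundary G.vert) ≤ LinearMap.ker (boundary G.face) := by
  rintro _ ⟨x, rfl⟩
  rw [LinearMap.mem_ker]
  ext φ
  refine Eq.trans ?_ (sum_ite_apply_perm G.face_facePerm (x ∘ G.vert) φ)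
  rw [boundary_apply]
  refine Finset.sum_congr rfl fun h _ => ?_
  obtain ⟨e, b⟩ := h
  cases b <;> simp [vert_facePerm, opp_mk, coboundary_apply, add_comm]

variable {G} in
theorem map_cornerDiff_le [Fintype E] [DecidableEq V] [DecidableEq G.Face] :
    (LinearMap.ker G.cornerSum).map G.cornerDiff ≤
      (LinearMap.ker (boundary G.vert)).prod (LinearMap.ker (boundary G.face)) := by
  rintro _ ⟨f, hf, rfl⟩
  refine ⟨?_, ?_⟩
  · rw [SetLike.mem_coe, LinearMap.mem_ker]
    ext v
    refine Eq.trans ?_ (sum_ite_apply_perm G.vert_rot_inv f v)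
    simp only [boundary_apply, G.cornerDiff_of_mem_ker hf]
  · rw [SetLike.mem_coe, LinearMap.mem_ker]
    ext v
    refine Eq.trans ?_ (sum_ite_apply_perm G.face_facePerm f v)
    simp only [boundary_apply, G.cornerDiff_of_mem_ker hf]

/-- Without jumps, a function of the corner is invariant under `rot` and `facePerm`, hence under
`opp`. -/
theorem ker_cornerDiff_inf : LinearMap.ker G.cornerDiff ⊓ LinearMap.ker G.cornerSum =
    G.invariants := by
  ext f
  rw [Submodule.mem_inf]
  constructor
  · rintro ⟨h0, hf⟩
    have hd := G.cornerDiff_of_mem_ker hf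
    rw [LinearMap.mem_ker.1 h0] at hd
    have h1 : ∀ h, f (G.rot h) = f h := fun h => by
      have := (hd (G.rot h)).1
      rw [perm_inv_apply_self] at this
      exact (zmod_two_add_eq_zero_iff _ _).1 this.symm
    refine fun h => ⟨h1 h, ?_⟩
    have := (hd h).2
    rw [facePerm_apply, ← h1 (G.rot⁻¹ _), perm_apply_inv_self] at this
    exact ((zmod_two_add_eq_zero_iff _ _).1 this.symm).symm
  · intro hf
    have h1 : ∀ h, f (G.rot⁻¹ h) = f h := fun h => by
      rw [← (hf (G.rot⁻¹ h)).1, perm_apply_inv_self]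
    have h2 : ∀ h, f (G.facePerm h) = f h := fun h => by
      rw [facePerm_apply, h1, (hf h).2]
    constructor
    · rw [LinearMap.mem_ker]
      refine Prod.ext (funext fun e => ?_) (funext fun e => ?_)
      · exact (zmod_two_add_eq_zero_iff _ _).2 (h1 _).symm
      · exact (zmod_two_add_eq_zero_iff _ _).2 (h2 _).symm
    · rw [LinearMap.mem_ker]
      ext e
      simp only [cornerSum_apply, h1, CharTwo.add_self_eq_zero, Finset.sum_const_zero,
        Pi.zero_apply]

/-! ### Euler's formula as a dimension count -/

section Planar

variable {G} [Fintype V] [DecidableEq V] [Fintype E]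

/-- Let c be the number of components, c' of those with an edge, and F' the number of faces bounded
by edges. Removing isolated vertices from Euler's formula leaves |V| + F' = |E| + c + c'. The first
equality reads |V| - c = |E| - F' + c'. In the second, the left side is (|E| + c') - c' = |E|, and
the right side is (|E| - |V| + c) + (|E| - F' + c'). -/
theorem IsPlanar.finrank_eqs [Fintype G.Face] [DecidableEq G.Face] (hG : G.IsPlanar) :
    Module.finrank (ZMod 2) (LinearMap.range (coboundary G.vert)) =
        Module.finrank (ZMod 2) (LinearMap.ker (boundary G.face)) ∧
      Module.finrank (ZMod 2) ((LinearMap.ker G.cornerSum).map G.cornerDiff) =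
        Module.finrank (ZMod 2)
          ((LinearMap.ker (boundary G.vert)).prod (LinearMap.ker (boundary G.face))) := by
  have h1 := finrank_ker_add_card_of_adjoint _ _ (coboundary_dotProduct G.vert)
  have h2 := finrank_ker_add_card_of_adjoint _ _ (coboundary_dotProduct G.face)
  have h3 := finrank_ker_add_card_of_adjoint _ _ G.cornerSumTranspose_dotProduct
  have h4 := (coboundary G.vert).finrank_range_add_finrank_ker
  have h5 := (G.cornerDiff.domRestrict (LinearMap.ker G.cornerSum)).finrank_range_add_finrank_ker
  have h6 := G.finrank_ker_coboundary_vert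
  have h7 := G.finrank_ker_coboundary_vert_eq_add
  rw [finrank_ker_coboundary_face] at h2
  rw [finrank_ker_cornerSumTranspose, Fintype.card_prod, Fintype.card_bool] at h3
  rw [Module.finrank_fintype_fun_eq_card] at h4
  rw [LinearMap.range_domRestrict,
    ← finrank_map_of_injective _ (Submodule.subtype_injective _) (LinearMap.ker _),
    LinearMap.ker_domRestrict, Submodule.map_comap_subtype, inf_comm, ker_cornerDiff_inf] at h5
  have h8 := hG
  rw [IsPlanar, numFaces] at h8
  simp only [Nat.card_eq_fintype_card (α := V), Nat.card_eq_fintype_card (α := E),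
    Nat.card_eq_fintype_card (α := G.Face)] at h8
  rw [finrank_submodule_prod]
  omega

theorem IsPlanar.range_coboundary [DecidableEq G.Face] (hG : G.IsPlanar) :
    LinearMap.range (coboundary G.vert) = LinearMap.ker (boundary G.face) := by
  have := Fintype.ofFinite G.Face
  exact Submodule.eq_of_le_of_finrank_eq range_coboundary_le hG.finrank_eqs.1

theorem IsPlanar.map_cornerDiff (hG : G.IsPlanar) :
    (LinearMap.ker G.cornerSum).map G.cornerDiff =
      (LinearMap.ker (boundary G.vert)).prod (LinearMap.range (coboundary G.vert)) := by
  classical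
  have := Fintype.ofFinite G.Face
  rw [hG.range_coboundary]
  exact Submodule.eq_of_le_of_finrank_eq map_cornerDiff_le hG.finrank_eqs.2

end Planar

end EmbeddedGraph

/-! ### The dimer partition function of `G^Q` -/

theorem existsUnique_and_three_iff {α : Type*} {a b c : α} (hab : a ≠ b) (hac : a ≠ c)
    (hbc : b ≠ c) (P : α → Prop) :
    (∃! x, P x ∧ (x = a ∨ x = b ∨ x = c)) ↔
      (P a ∧ ¬P b ∧ ¬P c) ∨ (¬P a ∧ P b ∧ ¬P c) ∨ (¬P a ∧ ¬P b ∧ P c) := by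
  constructor
  · rintro ⟨x, ⟨hx, rfl | rfl | rfl⟩, huniq⟩
    · exact Or.inl ⟨hx, fun h => hab (huniq _ ⟨h, by simp⟩).symm,
        fun h => hac (huniq _ ⟨h, by simp⟩).symm⟩
    · exact Or.inr (Or.inl ⟨fun h => hab (huniq _ ⟨h, by simp⟩), hx,
        fun h => hbc (huniq _ ⟨h, by simp⟩).symm⟩)
    · exact Or.inr (Or.inr ⟨fun h => hac (huniq _ ⟨h, by simp⟩),
        fun h => hbc (huniq _ ⟨h, by simp⟩), hx⟩)
  · rintro (⟨ha, hb, hc⟩ | ⟨ha, hb, hc⟩ | ⟨ha, hb, hc⟩)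
    · refine ⟨a, ⟨ha, by simp⟩, ?_⟩
      rintro _ ⟨h, rfl | rfl | rfl⟩ <;> tauto
    · refine ⟨b, ⟨hb, by simp⟩, ?_⟩
      rintro _ ⟨h, rfl | rfl | rfl⟩ <;> tauto
    · refine ⟨c, ⟨hc, by simp⟩, ?_⟩
      rintro _ ⟨h, rfl | rfl | rfl⟩ <;> tauto

theorem zmod_two_sum {A : Type*} [AddCommMonoid A] (f : ZMod 2 → A) :
    ∑ x, f x = f 0 + f 1 :=
  Fin.sum_univ_two f

theorem zmod_two_eq_zero_or_one (a : ZMod 2) : a = 0 ∨ a = 1 := by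
  revert a; decide

theorem sum_bool_arrow_zmod_two {A : Type*} [AddCommMonoid A] (f : (Bool → ZMod 2) → A) :
    ∑ x, f x = ∑ x : ZMod 2 × ZMod 2, f fun b => if b then x.2 else x.1 := by
  refine Fintype.sum_equiv (Equiv.boolArrowEquivProd _) _ _ fun x => congrArg f ?_
  ext b
  cases b <;> rfl

theorem prod_univ_ite_zero {ι : Type*} [Fintype ι] (p : ι → Prop) [DecidablePred p]
    [Decidable (∀ i, p i)] (f : ι → ℂ) :
    (∏ i, if p i then f i else 0) = if ∀ i, p i then ∏ i, f i else 0 := by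
  split_ifs with h
  · simp only [h, if_true]
  · obtain ⟨i, hi⟩ := not_forall.1 h
    exact Finset.prod_eq_zero (Finset.mem_univ i) (if_neg hi)

/-- Exactly one of the three indicators is `1`. -/
def ExactlyOne (a b c : ZMod 2) : Prop :=
  (a = 1 ∧ b = 0 ∧ c = 0) ∨ (a = 0 ∧ b = 1 ∧ c = 0) ∨ (a = 0 ∧ b = 0 ∧ c = 1)
  deriving Decidable

namespace EmbeddedGraph

variable {V E : Type*}

/-- The weight of an edge carrying `P` (for the primal edge) and `D` (for its dual edge). -/
def edgeWeight (t i : ℂ) (P D : ZMod 2) : ℂ :=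
  if P = 0 then (if D = 0 then 1 else i) else (if D = 0 then t else 0)

/-- The condition that the edges of a quadrangle with indicators `p` (parallel to the primal edge)
and `d` (parallel to the dual edge) match each vertex of the quadrangle once, together with the legs
with indicators `a` at the left and `r` at the right of the half-edges. -/
def QuadMatching (a r p d : Bool → ZMod 2) : Prop :=
  ∀ b, ExactlyOne (a b) (p b) (d b) ∧ ExactlyOne (r b) (p !b) (d b)
  deriving Decidable

/-- The total weight of a set of edges of a quadrangle. -/
def quadWeight (t i : ℂ) (p d : Bool → ZMod 2) : ℂ :=
  ∏ b, (if p b = 1 then t else 1) * (if d b = 1 then i else 1)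

/-- With no legs, the quadrangle has two matchings, of weights t² and i², summing to 1; with four
legs it needs no edge. Two legs leave two vertices, matched by a single edge if they are adjacent
and impossible to match if they are opposite, which is the case P = D = 1. An odd number of legs
leaves an odd number of vertices. -/
theorem sum_quadWeight {t i : ℂ} (hti : t * t + i * i = 1) (a r : Bool → ZMod 2) :
    (∑ q : (Bool → ZMod 2) × (Bool → ZMod 2),
      if QuadMatching a r q.1 q.2 then quadWeight t i q.1 q.2 else 0) =
    if ∑ b, (a b + r b) = 0 then
      edgeWeight t i (a false + r false) (a false + r true) else 0 := by
  simp only [Fintype.sum_prod_type, sum_bool_arrow_zmod_two, zmod_two_sum, QuadMatching, quadWeight,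
    Fintype.prod_bool, Fintype.sum_bool, Bool.forall_bool]
  have h2 : (1 + 1 : ZMod 2) = 0 := rfl
  obtain h0 | h0 := zmod_two_eq_zero_or_one (a false) <;>
  obtain h1 | h1 := zmod_two_eq_zero_or_one (a true) <;>
  obtain h3 | h3 := zmod_two_eq_zero_or_one (r false) <;>
  obtain h4 | h4 := zmod_two_eq_zero_or_one (r true) <;>
  simp [h0, h1, h3, h4, ExactlyOne, edgeWeight, h2, hti, add_comm]

variable (G : EmbeddedGraph V E)

theorem mem_qEnds_true (h : E × Bool) (f : QEdge E) :
    (h, true) ∈ G.qEnds f ↔ f = .leg h ∨ f = .primalParallel h ∨ f = .dualParallel h := by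
  cases f <;> simp [qEnds, eq_comm]

theorem mem_qEnds_false (h : E × Bool) (f : QEdge E) :
    (h, false) ∈ G.qEnds f ↔
      f = .leg (G.rot⁻¹ h) ∨ f = .primalParallel (opp h) ∨ f = .dualParallel h := by
  cases f with
  | leg k =>
    have : h = G.rot k ↔ k = G.rot⁻¹ h :=
      ⟨fun e => by rw [e, perm_inv_apply_self], fun e => by rw [e, perm_apply_inv_self]⟩
    simpa [qEnds] using this
  | primalParallel k =>
    have : h = opp k ↔ k = opp h := ⟨fun e => by rw [e, opp_opp], fun e => by rw [e, opp_opp]⟩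
    simpa [qEnds] using this
  | dualParallel k => simp [qEnds, eq_comm]

/-- The indicator of a set of edges of `G^Q`, from its restrictions to the legs and to the edges of the
quadrangles. -/
def qEdgeIndicator (x : (E × Bool → ZMod 2) × (E → (Bool → ZMod 2) × (Bool → ZMod 2))) :
    QEdge E → ZMod 2
  | .leg h => x.1 h
  | .primalParallel h => (x.2 h.1).1 h.2
  | .dualParallel h => (x.2 h.1).2 h.2

/-- A set of edges of `G^Q` as the indicators of its legs and, for each quadrangle, of its edges
parallel to the primal and to the dual edge. -/
def qEdgeSetEquiv (E : Type*) [Fintype E] [DecidableEq E] : Finset (QEdge E) ≃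
    (E × Bool → ZMod 2) × (E → (Bool → ZMod 2) × (Bool → ZMod 2)) where
  toFun M := (fun h => if .leg h ∈ M then 1 else 0,
    fun e => (fun b => if .primalParallel (e, b) ∈ M then 1 else 0,
      fun b => if .dualParallel (e, b) ∈ M then 1 else 0))
  invFun x := Finset.univ.filter fun f => qEdgeIndicator x f = 1
  left_inv M := by
    ext f
    cases f <;> simp [qEdgeIndicator]
  right_inv x := by
    have key : ∀ a : ZMod 2, (if a = 1 then (1 : ZMod 2) else 0) = a := by decide
    simp only [Finset.mem_filter, Finset.mem_univ, true_and, key]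
    rfl

theorem mem_qEdgeSetEquiv_symm [Fintype E] [DecidableEq E]
    (x : (E × Bool → ZMod 2) × (E → (Bool → ZMod 2) × (Bool → ZMod 2))) (f : QEdge E) :
    f ∈ (qEdgeSetEquiv E).symm x ↔ qEdgeIndicator x f = 1 := by
  simp [qEdgeSetEquiv]

theorem prod_qEdge [Fintype E] (w : QEdge E → ℂ) :
    ∏ f, w f = ∏ e, ((∏ b, w (.leg (e, b))) *
      ∏ b, w (.primalParallel (e, b)) * w (.dualParallel (e, b))) := by
  let φ : (E × Bool) ⊕ (E × Bool) ⊕ (E × Bool) ≃ QEdge E := {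
    toFun := fun x => match x with
      | .inl h => .leg h
      | .inr (.inl h) => .primalParallel h
      | .inr (.inr h) => .dualParallel h
    invFun := fun f => match f with
      | .leg h => .inl h
      | .primalParallel h => .inr (.inl h)
      | .dualParallel h => .inr (.inr h)
    left_inv := by rintro (h | h | h) <;> rfl
    right_inv := by rintro (h | h | h) <;> rfl }
  rw [← Equiv.prod_comp φ, Fintype.prod_sum_type, Fintype.prod_sum_type]
  simp only [Fintype.prod_prod_type, Finset.prod_mul_distrib]
  rfl

theorem isDimer_qEdgeSetEquiv_symm [Fintype E] [DecidableEq E] (l : E × Bool → ZMod 2)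
    (q : E → (Bool → ZMod 2) × (Bool → ZMod 2)) :
    IsDimer G.qEnds ((qEdgeSetEquiv E).symm (l, q)) ↔
      ∀ e, QuadMatching (fun b => l (e, b)) (fun b => l (G.rot⁻¹ (e, b))) (q e).1 (q e).2 := by
  have hne : ∀ a : ZMod 2, ¬ a = 1 ↔ a = 0 := by decide
  simp only [IsDimer, Prod.forall (α := E × Bool), Bool.forall_bool, mem_qEnds_true,
    mem_qEnds_false]
  have h1 := fun a b c : E × Bool => existsUnique_and_three_iff (a := QEdge.leg a)
    (b := .primalParallel b) (c := .dualParallel c) (by simp) (by simp) (by simp)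
    (· ∈ (qEdgeSetEquiv E).symm (l, q))
  simp only [h1]
  simp only [mem_qEdgeSetEquiv_symm, hne]
  simp only [qEdgeIndicator, QuadMatching, ExactlyOne]
  rw [Prod.forall]
  exact forall_congr' fun e => forall_congr' fun b => and_comm

theorem prod_qEdgeSetEquiv_symm [Fintype E] [DecidableEq E] (l : E × Bool → ZMod 2)
    (q : E → (Bool → ZMod 2) × (Bool → ZMod 2)) (K : E → ℂ) :
    ∏ f ∈ (qEdgeSetEquiv E).symm (l, q), dimerWeight K f =
      ∏ e, quadWeight (Complex.tanh (2 * K e)) (Complex.cosh (2 * K e))⁻¹ (q e).1 (q e).2 := by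
  simp only [qEdgeSetEquiv, Equiv.coe_fn_symm_mk]
  rw [Finset.prod_filter, prod_qEdge]
  have hleg : ∀ h, (if qEdgeIndicator (l, q) (.leg h) = 1 then dimerWeight K (.leg h) else 1) = 1 :=
    fun h => ite_self 1
  simp only [hleg, Finset.prod_const_one, one_mul]
  rfl

/-- Every vertex lies in one quadrangle and on one leg, so for fixed legs the sum factors over the
quadrangles. -/
theorem dimerZ_eq_sum_legs [Fintype E] [DecidableEq E] {K : E → ℂ}
    (hK : ∀ e, Complex.cosh (2 * K e) ≠ 0) :
    dimerZ G.qEnds (dimerWeight K) = ∑ l : E × Bool → ZMod 2, ∏ e,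
      if G.cornerSum l e = 0 then
        edgeWeight (Complex.tanh (2 * K e)) (Complex.cosh (2 * K e))⁻¹
          ((G.cornerDiff l).1 e) ((G.cornerDiff l).2 e) else 0 := by
  have hti : ∀ e, Complex.tanh (2 * K e) * Complex.tanh (2 * K e) +
      (Complex.cosh (2 * K e))⁻¹ * (Complex.cosh (2 * K e))⁻¹ = 1 := by
    intro e
    have h1 := Complex.cosh_sq (2 * K e)
    have h2 := hK e
    rw [Complex.tanh_eq_sinh_div_cosh]
    field_simp
    rw [h1]
  classical
  rw [dimerZ, Finset.sum_filter, ← Equiv.sum_comp (qEdgeSetEquiv E).symm, Fintype.sum_prod_type]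
  refine Finset.sum_congr rfl fun l _ => ?_
  -- The match is definitional: `facePerm (e, false)` unfolds to `rot⁻¹ (e, true)`, so the second
  -- jump is `a false + r true`.
  have h1 : ∀ e, (if G.cornerSum l e = 0 then
        edgeWeight (Complex.tanh (2 * K e)) (Complex.cosh (2 * K e))⁻¹
          ((G.cornerDiff l).1 e) ((G.cornerDiff l).2 e) else 0) = _ := fun e =>
    (sum_quadWeight (hti e) (fun b => l (e, b)) (fun b => l (G.rot⁻¹ (e, b)))).symm
  simp only [h1]
  rw [Finset.prod_univ_sum, Fintype.piFinset_univ]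
  refine Finset.sum_congr rfl fun q _ => ?_
  rw [prod_univ_ite_zero, prod_qEdgeSetEquiv_symm]
  exact if_congr (G.isDimer_qEdgeSetEquiv_symm l q) rfl rfl

/-- The number of leg configurations that give the same pair of contour configurations. -/
noncomputable def legMultiplicity : ℕ :=
  Nat.card (LinearMap.ker (G.cornerDiff.domRestrict (LinearMap.ker G.cornerSum)))

open Classical in
/-- The dimer partition function as a sum over pairs of disjoint primal and dual contours. -/
theorem IsPlanar.dimerZ_eq [Fintype V] [DecidableEq V] [Fintype E] {G : EmbeddedGraph V E}
    (hG : G.IsPlanar) {K : E → ℂ} (hK : ∀ e, Complex.cosh (2 * K e) ≠ 0) :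
    dimerZ G.qEnds (dimerWeight K) = (G.legMultiplicity : ℂ) *
      ∑ P with P ∈ LinearMap.ker (boundary G.vert),
        ∑ D with D ∈ LinearMap.range (coboundary G.vert),
          ∏ e, edgeWeight (Complex.tanh (2 * K e)) (Complex.cosh (2 * K e))⁻¹ (P e) (D e) := by
  let g : (E → ZMod 2) × (E → ZMod 2) → ℂ := fun x =>
    ∏ e, edgeWeight (Complex.tanh (2 * K e)) (Complex.cosh (2 * K e))⁻¹ (x.1 e) (x.2 e)
  have h1 := sum_comp_linearMap (G.cornerDiff.domRestrict (LinearMap.ker G.cornerSum)) g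
  have h2 : ∀ x, x ∈ LinearMap.range (G.cornerDiff.domRestrict (LinearMap.ker G.cornerSum)) ↔
      x.1 ∈ LinearMap.ker (boundary G.vert) ∧ x.2 ∈ LinearMap.range (coboundary G.vert) := by
    intro x
    rw [LinearMap.range_domRestrict, hG.map_cornerDiff]
    rfl
  have h3 : dimerZ G.qEnds (dimerWeight K) =
      ∑ l, g (G.cornerDiff.domRestrict (LinearMap.ker G.cornerSum) l) := by
    rw [G.dimerZ_eq_sum_legs hK]
    have h4 : ∀ l : E × Bool → ZMod 2, (∏ e, if G.cornerSum l e = 0 then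
        edgeWeight (Complex.tanh (2 * K e)) (Complex.cosh (2 * K e))⁻¹
          ((G.cornerDiff l).1 e) ((G.cornerDiff l).2 e) else 0) =
        if ∀ e, G.cornerSum l e = 0 then g (G.cornerDiff l) else 0 :=
      fun l => prod_univ_ite_zero _ _
    simp only [h4, LinearMap.domRestrict_apply]
    rw [← Finset.sum_filter]
    -- The edgewise parity constraints together say that the legs lie in the kernel of `cornerSum`.
    refine Finset.sum_subtype (p := (· ∈ LinearMap.ker G.cornerSum)) _ (fun l => ?_)
      fun l => g (G.cornerDiff l)
    simp [LinearMap.mem_ker, funext_iff]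
  rw [h3, h1, legMultiplicity]
  congr 1
  simp only [Finset.sum_filter, h2, Fintype.sum_prod_type, ite_and, g]
  refine Finset.sum_congr rfl fun P _ => ?_
  split_ifs <;> simp

end EmbeddedGraph

/-! ### The square of the Ising partition function -/

/-- The sign `(-1) ^ a`. -/
def zmodSign (a : ZMod 2) : ℂ := if a = 0 then 1 else -1

@[simp] theorem zmodSign_zero : zmodSign 0 = 1 := rfl

@[simp] theorem zmodSign_one : zmodSign 1 = -1 := by simp [zmodSign]

theorem zmodSign_add (a b : ZMod 2) : zmodSign (a + b) = zmodSign a * zmodSign b := by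
  have h2 : (1 + 1 : ZMod 2) = 0 := rfl
  obtain rfl | rfl := zmod_two_eq_zero_or_one a <;>
  obtain rfl | rfl := zmod_two_eq_zero_or_one b <;> simp [h2]

theorem zmodSign_sum {ι : Type*} (s : Finset ι) (f : ι → ZMod 2) :
    zmodSign (∑ i ∈ s, f i) = ∏ i ∈ s, zmodSign (f i) := by
  classical
  induction s using Finset.induction_on with
  | empty => simp
  | insert a s ha ih => rw [Finset.sum_insert ha, Finset.prod_insert ha, zmodSign_add, ih]

theorem sum_zmodSign_dotProduct {V : Type*} [Fintype V] [DecidableEq V] (w : V → ZMod 2) :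
    ∑ x : V → ZMod 2, zmodSign (x ⬝ᵥ w) = if w = 0 then 2 ^ Fintype.card V else 0 := by
  simp only [dotProduct, zmodSign_sum]
  rw [← Fintype.piFinset_univ, ← Finset.prod_univ_sum (fun _ : V => (Finset.univ : Finset (ZMod 2)))
    fun v a => zmodSign (a * w v)]
  simp only [zmod_two_sum, zero_mul, one_mul, zmodSign_zero]
  split_ifs with h
  · subst h
    simp only [Pi.zero_apply, zmodSign_zero, Finset.prod_const, Finset.card_univ]
    norm_num
  · obtain ⟨v, hv⟩ := Function.ne_iff.1 h
    refine Finset.prod_eq_zero (Finset.mem_univ v) ?_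
    rw [(zmod_two_eq_zero_or_one (w v)).resolve_left hv, zmodSign_one]
    norm_num

namespace EmbeddedGraph

variable {V E : Type*} [Fintype V] [DecidableEq V] [Fintype E] (G : EmbeddedGraph V E)

/-- The Ising partition function for complex coupling constants, the spin at `v` being
`(-1) ^ x v`. -/
noncomputable def complexIsingZ (K : E → ℂ) : ℂ :=
  ∑ x : V → ZMod 2, ∏ e, Complex.exp (K e * zmodSign (coboundary G.vert x e))

/-- For `d = 1` the exponents cancel and the product is 1 = cosh(2K) · 1/cosh(2K). For `d = 0` it is
exp(±2K) = cosh(2K)(1 ± tanh(2K)), and `p` selects the term. -/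
theorem exp_mul_exp_eq_cosh_mul {K : ℂ} (hK : Complex.cosh (2 * K) ≠ 0) (a d : ZMod 2) :
    Complex.exp (K * zmodSign a) * Complex.exp (K * zmodSign (a + d)) =
      Complex.cosh (2 * K) * ∑ p : ZMod 2,
        edgeWeight (Complex.tanh (2 * K)) (Complex.cosh (2 * K))⁻¹ p d * zmodSign (a * p) := by
  have h2 : (1 + 1 : ZMod 2) = 0 := rfl
  have h3 := Complex.cosh_add_sinh (2 * K)
  have h4 := Complex.cosh_sub_sinh (2 * K)
  have h5 : Complex.cosh (2 * K) * (Complex.sinh (2 * K) / Complex.cosh (2 * K)) =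
      Complex.sinh (2 * K) := by field_simp
  rw [zmod_two_sum, ← Complex.exp_add, Complex.tanh_eq_sinh_div_cosh]
  obtain rfl | rfl := zmod_two_eq_zero_or_one a <;>
  obtain rfl | rfl := zmod_two_eq_zero_or_one d <;>
  simp [edgeWeight, h2, hK]
  · rw [mul_add, h5, mul_one, h3, two_mul]
  · rw [mul_add, mul_neg, h5, mul_one, ← sub_eq_add_neg (Complex.cosh _), h4, two_mul, neg_add]

open Classical in
theorem complexIsingZ_sq {K : E → ℂ} (hK : ∀ e, Complex.cosh (2 * K e) ≠ 0) :
    G.complexIsingZ K ^ 2 =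
      2 ^ Fintype.card V * (Nat.card (LinearMap.ker (coboundary G.vert)) : ℂ) *
      (∏ e, Complex.cosh (2 * K e)) *
      ∑ P with P ∈ LinearMap.ker (boundary G.vert),
        ∑ D with D ∈ LinearMap.range (coboundary G.vert),
          ∏ e, edgeWeight (Complex.tanh (2 * K e)) (Complex.cosh (2 * K e))⁻¹ (P e) (D e) := by
  set w : E → ZMod 2 → ZMod 2 → ℂ := fun e =>
    edgeWeight (Complex.tanh (2 * K e)) (Complex.cosh (2 * K e))⁻¹ with hw
  -- The second copy is written as `x + y`, so that `y` encodes the product of the two spin fields.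
  have h1 : G.complexIsingZ K ^ 2 = ∑ y : V → ZMod 2, ∑ x : V → ZMod 2, ∏ e,
      (Complex.exp (K e * zmodSign (coboundary G.vert x e)) *
        Complex.exp (K e * zmodSign (coboundary G.vert x e + coboundary G.vert y e))) := by
    rw [sq, complexIsingZ, Finset.sum_mul_sum]
    conv_rhs => rw [Finset.sum_comm]
    refine Finset.sum_congr rfl fun x _ => ?_
    rw [← Equiv.sum_comp (Equiv.addLeft x)]
    refine Finset.sum_congr rfl fun y _ => ?_
    simp only [Equiv.coe_addLeft, map_add, Pi.add_apply, Finset.prod_mul_distrib]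
  have h2 : ∀ y : V → ZMod 2, (∑ x : V → ZMod 2, ∏ e,
      (Complex.exp (K e * zmodSign (coboundary G.vert x e)) *
        Complex.exp (K e * zmodSign (coboundary G.vert x e + coboundary G.vert y e)))) =
      2 ^ Fintype.card V * (∏ e, Complex.cosh (2 * K e)) *
        ∑ P with P ∈ LinearMap.ker (boundary G.vert), ∏ e, w e (P e) (coboundary G.vert y e) := by
    intro y
    simp only [exp_mul_exp_eq_cosh_mul (hK _), Finset.prod_mul_distrib]
    rw [← Finset.mul_sum, mul_comm (2 ^ _ : ℂ), mul_assoc]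
    congr 1
    simp only [Finset.prod_univ_sum, Fintype.piFinset_univ, Finset.prod_mul_distrib,
      ← zmodSign_sum]
    rw [Finset.sum_comm, Finset.sum_filter, Finset.mul_sum]
    refine Finset.sum_congr rfl fun P _ => ?_
    rw [← Finset.mul_sum]
    -- By adjointness the sign attached to `P` is a character of `x` given by the boundary of `P`;
    -- summing over `x` keeps only even `P`.
    have h3 := sum_zmodSign_dotProduct (boundary G.vert P)
    simp only [← coboundary_dotProduct] at h3
    simp only [dotProduct] at h3
    rw [h3, LinearMap.mem_ker]
    split_ifs
    · rw [mul_comm]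
    · simp
  rw [h1]
  simp only [h2]
  rw [← Finset.mul_sum, Finset.sum_comm]
  have h4 := fun P : E → ZMod 2 =>
    sum_comp_linearMap (coboundary G.vert) fun D => ∏ e, w e (P e) (D e)
  simp only [h4, ← Finset.mul_sum]
  ring

theorem legMultiplicity_ne_zero {V E : Type*} [Finite E] (G : EmbeddedGraph V E) :
    (G.legMultiplicity : ℂ) ≠ 0 := by
  rw [Nat.cast_ne_zero, legMultiplicity]
  exact Nat.card_pos.ne'

/-- The constant relating the dimer partition function to the square of the Ising one. -/
noncomputable def doublingConstant : ℂ :=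
  2 ^ Fintype.card V * (Nat.card (LinearMap.ker (coboundary G.vert)) : ℂ) / G.legMultiplicity

theorem doublingConstant_ne_zero {V E : Type*} [Fintype V] [Finite E] (G : EmbeddedGraph V E) :
    G.doublingConstant ≠ 0 := by
  refine div_ne_zero (mul_ne_zero (pow_ne_zero _ two_ne_zero) ?_) G.legMultiplicity_ne_zero
  exact Nat.cast_ne_zero.2 Nat.card_pos.ne'

variable {G} in
theorem IsPlanar.complexIsingZ_sq_eq (hG : G.IsPlanar) {K : E → ℂ}
    (hK : ∀ e, Complex.cosh (2 * K e) ≠ 0) :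
    G.complexIsingZ K ^ 2 =
      G.doublingConstant * (∏ e, Complex.cosh (2 * K e)) * dimerZ G.qEnds (dimerWeight K) := by
  rw [hG.dimerZ_eq hK, G.complexIsingZ_sq hK, doublingConstant]
  have := G.legMultiplicity_ne_zero
  field_simp

end EmbeddedGraph

/-! ### Spin correlations and order variables along paths -/

/-- The spin `(-1) ^ a`. -/
def zmodSpin : ZMod 2 ≃ ℤˣ where
  toFun a := if a = 0 then 1 else -1
  invFun s := if s = 1 then 0 else 1
  left_inv := by decide
  right_inv := by decide

theorem zmodSpin_coe (a : ZMod 2) : (((zmodSpin a : ℤ) : ℝ) : ℂ) = zmodSign a := by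
  obtain rfl | rfl := zmod_two_eq_zero_or_one a <;> simp [zmodSpin]

/-- Doubling turns the shift into iπ, which negates cosh and sinh and thus preserves tanh. -/
theorem Complex.cosh_two_mul_add_I_mul_pi_div_two (x : ℂ) :
    Complex.cosh (2 * (x + Complex.I * ((Real.pi : ℂ) / 2))) = -Complex.cosh (2 * x) := by
  have : 2 * (x + Complex.I * ((Real.pi : ℂ) / 2)) = 2 * x + Real.pi * Complex.I := by ring
  rw [this, Complex.cosh_add, Complex.cosh_mul_I, Complex.sinh_mul_I]
  simp

theorem Complex.sinh_two_mul_add_I_mul_pi_div_two (x : ℂ) :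
    Complex.sinh (2 * (x + Complex.I * ((Real.pi : ℂ) / 2))) = -Complex.sinh (2 * x) := by
  have : 2 * (x + Complex.I * ((Real.pi : ℂ) / 2)) = 2 * x + Real.pi * Complex.I := by ring
  rw [this, Complex.sinh_add, Complex.cosh_mul_I, Complex.sinh_mul_I]
  simp

theorem exp_add_I_mul_pi_div_two_mul_zmodSign (x : ℂ) (a : ZMod 2) :
    Complex.exp ((x + Complex.I * ((Real.pi : ℂ) / 2)) * zmodSign a) =
      Complex.I * zmodSign a * Complex.exp (x * zmodSign a) := by
  have h1 : Complex.exp (Complex.I * ((Real.pi : ℂ) / 2)) = Complex.I := by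
    rw [mul_comm, Complex.exp_pi_div_two_mul_I]
  obtain rfl | rfl := zmod_two_eq_zero_or_one a
  · simp only [zmodSign_zero, mul_one, Complex.exp_add, h1]
    ring
  · simp only [zmodSign_one, mul_neg, mul_one, neg_add, Complex.exp_add, Complex.exp_neg, h1,
      Complex.inv_I]
    ring

theorem two_mul_lt_two_mul {n : ℕ} (j : Fin n) : 2 * j.1 < 2 * n := by
  have := j.2
  lia

theorem two_mul_add_one_lt_two_mul {n : ℕ} (j : Fin n) : 2 * j.1 + 1 < 2 * n := by
  have := j.2
  lia

theorem prod_fin_two_mul {M : Type*} [CommMonoid M] (n : ℕ) (g : Fin (2 * n) → M) :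
    ∏ k, g k = ∏ j : Fin n, g ⟨2 * j.1, two_mul_lt_two_mul j⟩ *
      g ⟨2 * j.1 + 1, two_mul_add_one_lt_two_mul j⟩ := by
  have key : ∀ (m : ℕ) (f : ℕ → M), ∏ i ∈ Finset.range (2 * m), f i =
      ∏ j ∈ Finset.range m, f (2 * j) * f (2 * j + 1) := by
    intro m f
    induction m with
    | zero => simp
    | succ m ih =>
      rw [Nat.mul_succ, Finset.prod_range_succ, Finset.prod_range_succ, ih,
        Finset.prod_range_succ _ m, mul_assoc]
  -- The default value 1 is never read: all indices stay below `2 * n`.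
  have h := key n fun i => if hi : i < 2 * n then g ⟨i, hi⟩ else 1
  rw [Finset.prod_range, Finset.prod_range] at h
  simp only [Fin.is_lt, dif_pos] at h
  refine h.trans (Finset.prod_congr rfl fun j _ => ?_)
  rw [dif_pos (two_mul_lt_two_mul j), dif_pos (two_mul_add_one_lt_two_mul j)]

namespace EmbeddedGraph

variable {V E : Type*} (G : EmbeddedGraph V E)

/-- The product of the spins at the ends of an edge. -/
def edgeSpin (s : V → ℤˣ) (e : E) : ℤˣ := s (G.vert (e, false)) * s (G.vert (e, true))

theorem edgeSpin_fst (s : V → ℤˣ) (h : E × Bool) :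
    G.edgeSpin s h.1 = s (G.vert h) * s (G.vert (opp h)) := by
  obtain ⟨e, b⟩ := h
  cases b
  · rfl
  · exact mul_comm _ _

theorem IsWalk.prod_edgeSpin {G : EmbeddedGraph V E} (s : V → ℤˣ) {u v : V}
    {l : List (E × Bool)} (hl : G.IsWalk u l v) :
    (l.map fun h => G.edgeSpin s h.1).prod = s u * s v := by
  induction l generalizing u with
  | nil =>
    obtain rfl : u = v := hl
    simp [Int.units_mul_self]
  | cons h l ih =>
    obtain ⟨rfl, hl⟩ := hl
    rw [List.map_cons, List.prod_cons, ih hl, edgeSpin_fst, mul_assoc,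
      ← mul_assoc (s (G.vert (opp h))), Int.units_mul_self, one_mul]

/-- Reusing an edge in the same direction repeats its end vertex; reusing it backwards returns to
its starting vertex. -/
theorem IsPath.nodup_edges {G : EmbeddedGraph V E} {u v : V} {l : List (E × Bool)}
    (hl : G.IsPath u l v) : (l.map Prod.fst).Nodup := by
  induction l generalizing u with
  | nil => simp
  | cons h l ih =>
    obtain ⟨⟨rfl, hw⟩, hn⟩ := hl
    rw [List.map_cons, List.nodup_cons] at hn ⊢
    refine ⟨fun hmem => ?_, ih ⟨hw, hn.2⟩⟩
    obtain ⟨k, hk, hkh⟩ := List.mem_map.1 hmem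
    obtain rfl | rfl : k = h ∨ k = opp h := by
      obtain ⟨e, b⟩ := h
      obtain ⟨e', b'⟩ := k
      obtain rfl : e' = e := hkh
      cases b <;> cases b' <;> simp [opp_mk]
    · exact (List.nodup_cons.1 hn.2).1 (List.mem_map.2 ⟨k, hk, rfl⟩)
    · refine hn.1 (List.mem_cons_of_mem _ (List.mem_map.2 ⟨opp h, hk, ?_⟩))
      rw [opp_opp]

open Classical in
theorem prod_edgeSpin_pathEdges [Fintype E] (s : V → ℤˣ) (n : ℕ) (u : Fin (2 * n) → V)
    (γ : Fin n → List (E × Bool))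
    (hpath : ∀ j : Fin n,
      G.IsPath (u ⟨2 * j.1, two_mul_lt_two_mul j⟩) (γ j)
        (u ⟨2 * j.1 + 1, two_mul_add_one_lt_two_mul j⟩))
    (hdisj : ∀ i j : Fin n, i ≠ j → ∀ h ∈ γ i, ∀ h' ∈ γ j, h.1 ≠ h'.1) :
    ∏ e with e ∈ pathEdges γ, G.edgeSpin s e = ∏ k, s (u k) := by
  have h1 : (Finset.univ.filter (· ∈ pathEdges γ)) =
      Finset.univ.biUnion fun j => ((γ j).map Prod.fst).toFinset := by
    ext e
    simp [pathEdges]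
  rw [h1, Finset.prod_biUnion, prod_fin_two_mul]
  · refine Finset.prod_congr rfl fun j _ => ?_
    rw [List.prod_toFinset _ (hpath j).nodup_edges, List.map_map]
    exact (hpath j).1.prod_edgeSpin s
  · intro i _ j _ hij
    rw [Function.onFun, Finset.disjoint_left]
    intro e hi hj
    rw [List.mem_toFinset, List.mem_map] at hi hj
    obtain ⟨h, hh, rfl⟩ := hi
    obtain ⟨h', hh', hhh⟩ := hj
    exact hdisj i j hij h hh h' hh' hhh.symm

theorem orderCoupling_empty (J : E → ℝ) : orderCoupling J ∅ = coupling J := by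
  ext e
  simp [orderCoupling, coupling]

theorem cosh_orderCoupling (J : E → ℝ) (Γ : Set E) (e : E) [Decidable (e ∈ Γ)] :
    Complex.cosh (2 * orderCoupling J Γ e) =
      (if e ∈ Γ then -1 else 1) * Complex.cosh (2 * coupling J e) := by
  by_cases he : e ∈ Γ
  · simp [orderCoupling, coupling, he, Complex.cosh_two_mul_add_I_mul_pi_div_two]
  · simp [orderCoupling, coupling, he]

theorem tanh_orderCoupling (J : E → ℝ) (Γ : Set E) (e : E) :
    Complex.tanh (2 * orderCoupling J Γ e) = Complex.tanh (2 * coupling J e) := by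
  by_cases he : e ∈ Γ
  · simp [orderCoupling, coupling, he, Complex.tanh_eq_sinh_div_cosh,
      Complex.cosh_two_mul_add_I_mul_pi_div_two, Complex.sinh_two_mul_add_I_mul_pi_div_two]
  · simp [orderCoupling, coupling, he]

theorem cosh_coupling (J : E → ℝ) (e : E) :
    Complex.cosh (2 * coupling J e) = (Real.cosh (2 * J e) : ℝ) := by
  simp [coupling]

theorem cosh_coupling_ne_zero (J : E → ℝ) (e : E) : Complex.cosh (2 * coupling J e) ≠ 0 := by
  rw [cosh_coupling]
  exact Complex.ofReal_ne_zero.2 (Real.cosh_pos _).ne'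

theorem cosh_orderCoupling_ne_zero (J : E → ℝ) (Γ : Set E) (e : E) :
    Complex.cosh (2 * orderCoupling J Γ e) ≠ 0 := by
  classical
  rw [cosh_orderCoupling]
  refine mul_ne_zero ?_ (cosh_coupling_ne_zero J e)
  split_ifs <;> norm_num

variable [Fintype V] [DecidableEq V] [Fintype E]

open Classical in
/-- Order variables insert the product of the spins at the ends of the modified edges. -/
theorem complexIsingZ_orderCoupling (J : E → ℝ) (Γ : Set E) :
    G.complexIsingZ (orderCoupling J Γ) = Complex.I ^ (Finset.univ.filter (· ∈ Γ)).card *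
      ((∑ s : V → ℤˣ, Real.exp (G.isingExponent J s) *
        (((∏ e with e ∈ Γ, G.edgeSpin s e : ℤˣ) : ℤ) : ℝ) : ℝ) : ℂ) := by
  rw [complexIsingZ, Complex.ofReal_sum, Finset.mul_sum]
  refine Fintype.sum_equiv (Equiv.arrowCongr (Equiv.refl V) zmodSpin) _ _ fun x => ?_
  set s : V → ℤˣ := Equiv.arrowCongr (Equiv.refl V) zmodSpin x with hs
  have hsx : ∀ v, (((s v : ℤ) : ℝ) : ℂ) = zmodSign (x v) := fun v => zmodSpin_coe (x v)
  have hse : ∀ e, (((G.edgeSpin s e : ℤ) : ℝ) : ℂ) = zmodSign (coboundary G.vert x e) := by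
    intro e
    rw [coboundary_apply, zmodSign_add, ← hsx, ← hsx, edgeSpin]
    push_cast
    rfl
  have h1 : (Real.exp (G.isingExponent J s) : ℂ) =
      ∏ e, Complex.exp (J e * zmodSign (coboundary G.vert x e)) := by
    rw [Complex.ofReal_exp, isingExponent, Complex.ofReal_sum, Complex.exp_sum]
    refine Finset.prod_congr rfl fun e _ => ?_
    rw [Complex.ofReal_mul, Complex.ofReal_mul, hsx, hsx, mul_assoc, ← zmodSign_add]
    rfl
  have h2 : ((((∏ e with e ∈ Γ, G.edgeSpin s e : ℤˣ) : ℤ) : ℝ) : ℂ) =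
      ∏ e with e ∈ Γ, zmodSign (coboundary G.vert x e) := by
    rw [Units.coe_prod, Int.cast_prod, Complex.ofReal_prod]
    exact Finset.prod_congr rfl fun e _ => hse e
  rw [Complex.ofReal_mul, h1, h2, ← Finset.prod_const, mul_left_comm, ← Finset.prod_mul_distrib,
    Finset.prod_filter, ← Finset.prod_mul_distrib]
  refine Finset.prod_congr rfl fun e _ => ?_
  by_cases he : e ∈ Γ
  · simp only [orderCoupling, he, if_true, exp_add_I_mul_pi_div_two_mul_zmodSign]
    ring
  · simp [orderCoupling, he]

theorem complexIsingZ_coupling (J : E → ℝ) : G.complexIsingZ (coupling J) = (G.isingZ J : ℂ) := by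
  rw [← orderCoupling_empty, complexIsingZ_orderCoupling]
  simp [isingZ]

theorem isingZ_pos (J : E → ℝ) : 0 < G.isingZ J :=
  Finset.sum_pos (fun _ _ => Real.exp_pos _) Finset.univ_nonempty

theorem isingExp_eq_div (J : E → ℝ) (f : (V → ℤˣ) → ℝ) :
    G.isingExp J f = (∑ s, Real.exp (G.isingExponent J s) * f s) / G.isingZ J := by
  rw [isingExp, Finset.sum_div]
  exact Finset.sum_congr rfl fun s _ => by rw [isingProb, div_mul_eq_mul_div]

variable {G} in
theorem IsPlanar.dimerZ_coupling_ne_zero (hG : G.IsPlanar) (J : E → ℝ) :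
    dimerZ G.qEnds (dimerWeight (coupling J)) ≠ 0 := by
  intro h0
  have h := hG.complexIsingZ_sq_eq (cosh_coupling_ne_zero J)
  rw [h0, mul_zero, complexIsingZ_coupling] at h
  exact pow_ne_zero 2 (Complex.ofReal_ne_zero.2 (G.isingZ_pos J).ne') h

variable {G} in
open Classical in
-- Quotient of the doubling identity at the modified and the original couplings; it holds for an
-- arbitrary edge set Γ.
theorem IsPlanar.isingExp_edgeSpin_sq (hG : G.IsPlanar) (J : E → ℝ) (Γ : Set E) :
    (((G.isingExp J fun s => (((∏ e with e ∈ Γ, G.edgeSpin s e : ℤˣ) : ℤ) : ℝ)) ^ 2 : ℝ) : ℂ) =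
      dimerZ G.qEnds (dimerWeight (orderCoupling J Γ)) /
        dimerZ G.qEnds (dimerWeight (coupling J)) := by
  have h1 := hG.complexIsingZ_sq_eq (cosh_coupling_ne_zero J)
  have h2 := hG.complexIsingZ_sq_eq (cosh_orderCoupling_ne_zero J Γ)
  rw [complexIsingZ_coupling] at h1
  simp only [complexIsingZ_orderCoupling, cosh_orderCoupling, Finset.prod_mul_distrib] at h2
  -- Both (i^|Γ|)² and the product of the modified cosh factors contribute (-1)^|Γ|, which `h3`
  -- cancels.
  rw [← Finset.prod_filter, Finset.prod_const, mul_pow, ← pow_mul, mul_comm _ 2, pow_mul,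
    Complex.I_sq] at h2
  have hsign : ((-1 : ℂ) ^ (Finset.univ.filter (· ∈ Γ)).card) ≠ 0 :=
    pow_ne_zero _ (neg_ne_zero.2 one_ne_zero)
  have hZ : (G.isingZ J : ℂ) ≠ 0 := Complex.ofReal_ne_zero.2 (G.isingZ_pos J).ne'
  have hC : G.doublingConstant * ∏ e, Complex.cosh (2 * coupling J e) ≠ 0 :=
    mul_ne_zero G.doublingConstant_ne_zero
      (Finset.prod_ne_zero_iff.2 fun e _ => cosh_coupling_ne_zero J e)
  have h3 := mul_left_cancel₀ hsign (h2.trans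
    (by ring : _ = _ * ((G.doublingConstant * ∏ e, Complex.cosh (2 * coupling J e)) *
      dimerZ G.qEnds (dimerWeight (orderCoupling J Γ)))))
  rw [isingExp_eq_div, Complex.ofReal_pow, Complex.ofReal_div, div_pow, h3, h1,
    mul_div_mul_left _ _ hC]

end EmbeddedGraph

/-! ### The main theorem -/

theorem mainTheorem2 {V E : Type*} [Fintype V] [DecidableEq V] [Fintype E]
    (G : EmbeddedGraph V E) (hG : G.IsPlanar)
    (J : E → ℝ) (hJ : ∀ e, 0 < J e)
    (n : ℕ) (u : Fin (2 * n) → V)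
    (γ : Fin n → List (E × Bool))
    (hpath : ∀ j : Fin n,
      G.IsPath (u ⟨2 * j.1, by omega⟩) (γ j) (u ⟨2 * j.1 + 1, by omega⟩))
    (hdisj : ∀ i j : Fin n, i ≠ j → ∀ h ∈ γ i, ∀ h' ∈ γ j, h.1 ≠ h'.1) :
    (∀ h : E × Bool,
      EmbeddedGraph.dimerWeight (EmbeddedGraph.orderCoupling J (EmbeddedGraph.pathEdges γ))
        (.leg h) = 1) ∧
    (∀ h : E × Bool,
      EmbeddedGraph.dimerWeight (EmbeddedGraph.orderCoupling J (EmbeddedGraph.pathEdges γ))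
        (.primalParallel h) = (Real.tanh (2 * J h.1) : ℂ)) ∧
    (∀ h : E × Bool, h.1 ∉ EmbeddedGraph.pathEdges γ →
      EmbeddedGraph.dimerWeight (EmbeddedGraph.orderCoupling J (EmbeddedGraph.pathEdges γ))
        (.dualParallel h) = ((1 / Real.cosh (2 * J h.1) : ℝ) : ℂ)) ∧
    (∀ h : E × Bool, h.1 ∈ EmbeddedGraph.pathEdges γ →
      EmbeddedGraph.dimerWeight (EmbeddedGraph.orderCoupling J (EmbeddedGraph.pathEdges γ))
        (.dualParallel h) = ((-(1 / Real.cosh (2 * J h.1)) : ℝ) : ℂ)) ∧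
    dimerZ G.qEnds (EmbeddedGraph.dimerWeight (EmbeddedGraph.coupling J)) ≠ 0 ∧
    (((G.isingExp J fun s => ∏ j : Fin (2 * n), ((s (u j) : ℤ) : ℝ)) ^ 2 : ℝ) : ℂ) =
      dimerZ G.qEnds
          (EmbeddedGraph.dimerWeight
            (EmbeddedGraph.orderCoupling J (EmbeddedGraph.pathEdges γ))) /
        dimerZ G.qEnds (EmbeddedGraph.dimerWeight (EmbeddedGraph.coupling J)) := by
  classical
  have hcosh := fun h : E × Bool =>
    EmbeddedGraph.cosh_orderCoupling J (EmbeddedGraph.pathEdges γ) h.1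
  refine ⟨fun h => rfl, fun h => ?_, fun h hh => ?_, fun h hh => ?_,
    hG.dimerZ_coupling_ne_zero J, ?_⟩
  · rw [EmbeddedGraph.dimerWeight, EmbeddedGraph.tanh_orderCoupling]
    simp [EmbeddedGraph.coupling]
  · rw [EmbeddedGraph.dimerWeight, hcosh, if_neg hh, EmbeddedGraph.cosh_coupling]
    simp
  · rw [EmbeddedGraph.dimerWeight, hcosh, if_pos hh, EmbeddedGraph.cosh_coupling, neg_one_mul,
      inv_neg]
    simp
  · rw [← hG.isingExp_edgeSpin_sq J (EmbeddedGraph.pathEdges γ)]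
    -- Disjointness of the paths lets each edge of Γ count once, and the spins at interior path
    -- vertices square to 1.
    simp only [G.prod_edgeSpin_pathEdges _ n u γ hpath hdisj, Units.coe_prod, Int.cast_prod]
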